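/- \textbf{The game.} Let $q,p>0$ with $p+q\le 1$, let $\gamma\ge 0$ and $n\in\mathbb N$. A network is a simple undirected graph $E$ on $[n]=\{1,\dots,n\}$; $N_i(E)$ is the set of neighbours of $i$ and $d_i=|N_i(E)|$. Each individual $i$ independently receives $X_i\in\{0,1,2\}$ exogenous opportunities, with $\Pr[X_i=0]=q$, $\Pr[X_i=1]=1-p-q$, $\Pr[X_i=2]=p$. Every individual $j$ with $X_j=2$ passes one opportunity to a uniformly random member of $\{k\in N_j(E): X_k=0\}$ if this set is nonempty, and passes nothing otherwise; given $(X_i)_i$, these choices are independent. Let $R_{ji}=1$ if $j$ passes an opportunity to $i$, and $R_{ji}=0$ otherwise. The utility of $i$ is $$u_i(E)=\mathbb E\Big[\min\Big\{1,\;X_i+\sum_{j\in N_i(E)}R_{ji}\Big\}\Big]-\gamma d_i ,$$ and the social welfare is $u_{[n]}(E)=\sum_{i} u_i(E)$. A network $E$ is a \emph{defection-free pairwise Nash equilibrium} (DFPNE) if (1) for all $i\ne j$ with $(i,j)\notin E$ and all $S_i\subseteq N_i(E)$, $S_j\subseteq N_j(E)$, one has $u_i\big((E\cup\{(i,j)\})\setminus\{(i,\ell):\ell\in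 S_i\}\big)\le u_i(E)$ or $u_j\big((E\cup\{(i,j)\})\setminus\{(j,\ell):\ell\in S_j\}\big)\le u_j(E)$; and (2) for all $(i,j)\in E$, $u_i(E\setminus\{(i,j)\})\le u_i(E)$ and $u_j(E\setminus\{(i,j)\})\le u_j(E)$. The price of anarchy is $$\mathrm{PoA}(n,q,p,\gamma)=\frac{\max_{E} u_{[n]}(E)}{\min_{E\text{ a DFPNE}} u_{[n]}(E)} .$$ \textbf{Theorem.} Let $q,p>0$ with $p+q\le 1$ be fixed and let $\gamma=0$. Then a DFPNE exists for every $n$, and as $n\to\infty$ $$\mathrm{PoA}(n,q,p,0)=\frac{\displaystyle\max_{d\in\mathbb N,\;0\le d\le n}\;\Big[1-q\Big(1-\frac pq\cdot\frac{1-(1-q)^d}{d}\Big)^d\Big]}{1-q\,e^{-p/q}}\pm o(1),$$ where the bracket is read as $1-q$ for $d=0$. -/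

import Mathlib

open Finset Filter Asymptotics

namespace IPNG

/-- The set `N_i(E)` of neighbours of `i` in the network `E`. -/
noncomputable def nbrs {n : ℕ} (E : SimpleGraph (Fin n)) (i : Fin n) : Finset (Fin n) := by
  classical exact {j | E.Adj i j}

/-- The law of the number of exogenous opportunities of one individual:
`0` with probability `q`, `1` with probability `1 - p - q`, `2` with probability `p`. -/
def exoProb (q p : ℝ) (m : Fin 3) : ℝ :=
  if m = 0 then q else if m = 1 then 1 - p - q else p

/-- The neighbours of `j` who received no exogenous opportunity,
when the realized exogenous opportunities are `x`. -/
noncomputable def needy {n : ℕ} (E : SimpleGraph (Fin n)) (x : Fin n → Fin 3) (j : Fin n) :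
    Finset (Fin n) :=
  {k ∈ nbrs E j | x k = 0}

/-- Informed transfer, given the exogenous opportunities `x`: the law of the recipient of the extra
opportunity of `j` (`none` means that `j` passes nothing). If `j` has two opportunities and some
neighbour without one, the recipient is uniform among these neighbours; otherwise nothing is
passed. -/
noncomputable def transferProb {n : ℕ} (E : SimpleGraph (Fin n)) (x : Fin n → Fin 3) (j : Fin n)
    (r : Option (Fin n)) : ℝ :=
  if x j = 2 ∧ (needy E x j).Nonempty then
    r.elim 0 (fun k => if k ∈ needy E x j then 1 / ((needy E x j).card : ℝ) else 0)
  else if r = none then 1 else 0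

/-- An outcome of the model: the exogenous opportunities of all individuals, and for every
individual the recipient (if any) of the extra opportunity. -/
abbrev Outcome (n : ℕ) : Type := (Fin n → Fin 3) × (Fin n → Option (Fin n))

/-- The probability of an outcome: exogenous opportunities are independent across individuals, and
given them the recipients are chosen independently. -/
noncomputable def outcomeProb {n : ℕ} (q p : ℝ) (E : SimpleGraph (Fin n)) (ω : Outcome n) : ℝ :=
  (∏ i, exoProb q p (ω.1 i)) * ∏ j, transferProb E ω.1 j (ω.2 j)

/-- `R_{ji}`: equal to `1` if `j` passes an opportunity to `i`, and `0` otherwise. -/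
def passes {n : ℕ} (ω : Outcome n) (j i : Fin n) : ℕ :=
  if ω.2 j = some i then 1 else 0

/-- `Y_i = min {1, X_i + ∑_{j ∈ N_i(E)} R_{ji}} - γ d_i`. -/
noncomputable def payoff {n : ℕ} (γ : ℝ) (E : SimpleGraph (Fin n)) (ω : Outcome n)
    (i : Fin n) : ℝ :=
  ((min 1 ((ω.1 i : ℕ) + ∑ j ∈ nbrs E i, passes ω j i) : ℕ) : ℝ) - γ * ((nbrs E i).card : ℝ)

/-- The expected utility `u_i(E; q, p, γ) = 𝔼[Y_i]`. -/
noncomputable def utility {n : ℕ} (q p γ : ℝ) (E : SimpleGraph (Fin n)) (i : Fin n) : ℝ :=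
  ∑ ω : Outcome n, outcomeProb q p E ω * payoff γ E ω i

/-- Social welfare: the sum of all expected utilities. -/
noncomputable def welfare {n : ℕ} (q p γ : ℝ) (E : SimpleGraph (Fin n)) : ℝ :=
  ∑ i, utility q p γ E i

/-- The network `(E ∪ {(i,j)}) \ {(i,ℓ) : ℓ ∈ S}`. -/
def addDrop {n : ℕ} (E : SimpleGraph (Fin n)) (i j : Fin n) (S : Set (Fin n)) :
    SimpleGraph (Fin n) :=
  (E ⊔ SimpleGraph.edge i j).deleteEdges ((fun l => s(i, l)) '' S)

/-- Defection-free pairwise Nash equilibrium. -/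
def IsDFPNE {n : ℕ} (q p γ : ℝ) (E : SimpleGraph (Fin n)) : Prop :=
  (∀ i j : Fin n, i ≠ j → ¬ E.Adj i j →
    ∀ Si Sj : Set (Fin n), Si ⊆ E.neighborSet i → Sj ⊆ E.neighborSet j →
      utility q p γ (addDrop E i j Si) i ≤ utility q p γ E i ∨
      utility q p γ (addDrop E j i Sj) j ≤ utility q p γ E j) ∧
  (∀ i j : Fin n, E.Adj i j →
    utility q p γ (E.deleteEdges {s(i, j)}) i ≤ utility q p γ E i ∧
    utility q p γ (E.deleteEdges {s(i, j)}) j ≤ utility q p γ E j)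

/-- The price of anarchy: the maximal social welfare of a network on `n` individuals divided by the
minimal social welfare of an equilibrium network. (There are finitely many networks, so both extrema
are attained as soon as an equilibrium exists.) -/
noncomputable def PoA (n : ℕ) (q p γ : ℝ) : ℝ :=
  (⨆ E : SimpleGraph (Fin n), welfare q p γ E) /
    sInf (welfare q p γ '' {E : SimpleGraph (Fin n) | IsDFPNE q p γ E})

end IPNG

/-!
# The price of anarchy of informed transfers without link costs

Let `f d = treeUtility q p d = 1 - q * (1 - p / q * (1 - (1 - q) ^ d) / d) ^ d`, the utility of an
individual in a `d`-regular tree.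

*Utilities.* Given that `i` has no opportunity, its neighbours miss it independently once the other
exogenous opportunities `x` are known, so that `u_i = 1 - q * 𝔼[∏ k ∈ N_i, missProb E i k x]`
(`utility_eq`). The factor of `k` involves only `k` and the neighbours of `k` other than `i`, and
its mean `missMean q p d_k` depends only on the degree `d_k` of `k` (`expect_missProb`).

*Equilibria.* A new link `ij` multiplies the product for `i` by one further factor, smaller than `1`
with positive probability, and leaves the other factors alone. Links being free, every missing link
is a profitable deviation, so the complete network is the only equilibrium (`isDFPNE_iff_eq_top`).
There about `p n` donors share about `q n` needy individuals, and the utility tends to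
`1 - q * exp (-p / q)`; the upper estimate of the expectation comes from second moments
(`le_utility_top`), the lower one from the next step (`tendsto_welfare_top_div`).

*Upper bound for the maximal welfare.* Every factor is antitone in `x`, so by the Harris inequality
the expectation of the product is at least the product of the means (`utility_le`). Multiplying
these bounds over all `i`, each `k` contributes `missMean q p d_k ^ d_k`, and the inequality of
arithmetic and geometric means bounds the welfare of every network by `n * max_d f d`
(`welfare_le`).

*Lower bound for the maximal welfare.* If `i` lies on no triangle and no cycle of length four, the
factors are independent and `u_i = f d` when the degrees around `i` are `d`. A bipartite shift graph
built on the powers of two has this property away from a bounded number of vertices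
(`le_welfare_powerShiftGraph`). Only finitely many degrees have to be realized in this way, since
`f d` tends to the per capita welfare of the complete network (`tendsto_iSup_welfare_div_sub`).
-/

namespace IPNG

/-! ### Expectations over the exogenous opportunities -/

/-- The expectation of `F` when the coordinates are independent with law `exoProb q p`. -/
noncomputable def expect {n : ℕ} (q p : ℝ) (F : (Fin n → Fin 3) → ℝ) : ℝ :=
  ∑ x, (∏ i, exoProb q p (x i)) * F x

section Expect

variable {n : ℕ} {q p : ℝ}

lemma sum_exoProb_mul (h : Fin 3 → ℝ) :
    ∑ m, exoProb q p m * h m = q * h 0 + (1 - p - q) * h 1 + p * h 2 := by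
  simp [Fin.sum_univ_three, exoProb]

lemma sum_exoProb : ∑ m, exoProb q p m = 1 := by
  have := sum_exoProb_mul (q := q) (p := p) (fun _ => 1)
  simp only [mul_one] at this
  rw [this]; ring

lemma exoProb_nonneg (hq : 0 < q) (hp : 0 < p) (hpq : p + q ≤ 1) (m : Fin 3) :
    0 ≤ exoProb q p m := by
  unfold exoProb
  split_ifs <;> linarith

lemma prod_exoProb_nonneg (hq : 0 < q) (hp : 0 < p) (hpq : p + q ≤ 1) (x : Fin n → Fin 3) :
    0 ≤ ∏ i, exoProb q p (x i) :=
  prod_nonneg fun _ _ => exoProb_nonneg hq hp hpq _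

lemma expect_prod_coord (h : Fin n → Fin 3 → ℝ) :
    expect q p (fun x => ∏ i, h i (x i)) = ∏ i, ∑ m, exoProb q p m * h i m := by
  unfold expect
  rw [Fintype.prod_sum]
  exact sum_congr rfl fun x _ => by rw [prod_mul_distrib]

lemma expect_const (c : ℝ) : expect q p (fun _ : Fin n → Fin 3 => c) = c := by
  have h := expect_prod_coord (n := n) (q := q) (p := p) (fun _ _ => 1)
  simp only [prod_const_one, mul_one, sum_exoProb] at h
  have h2 : expect q p (fun _ : Fin n → Fin 3 => c)
      = expect q p (fun _ : Fin n → Fin 3 => 1) * c := by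
    simp [expect, sum_mul]
  rw [h2, h, one_mul]

lemma expect_add (F G : (Fin n → Fin 3) → ℝ) :
    expect q p (fun x => F x + G x) = expect q p F + expect q p G := by
  simp [expect, mul_add, sum_add_distrib]

lemma expect_sub (F G : (Fin n → Fin 3) → ℝ) :
    expect q p (fun x => F x - G x) = expect q p F - expect q p G := by
  simp [expect, mul_sub, sum_sub_distrib]

lemma expect_const_mul (c : ℝ) (F : (Fin n → Fin 3) → ℝ) :
    expect q p (fun x => c * F x) = c * expect q p F := by
  simp only [expect, mul_sum]
  exact sum_congr rfl fun x _ => by ring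

lemma expect_sum {ι : Type*} (s : Finset ι) (F : ι → (Fin n → Fin 3) → ℝ) :
    expect q p (fun x => ∑ i ∈ s, F i x) = ∑ i ∈ s, expect q p (F i) := by
  simp only [expect, mul_sum]
  exact sum_comm

lemma expect_mono (hq : 0 < q) (hp : 0 < p) (hpq : p + q ≤ 1) {F G : (Fin n → Fin 3) → ℝ}
    (h : ∀ x, F x ≤ G x) : expect q p F ≤ expect q p G :=
  sum_le_sum fun x _ => mul_le_mul_of_nonneg_left (h x) (prod_exoProb_nonneg hq hp hpq x)

lemma expect_coord (i : Fin n) (h : Fin 3 → ℝ) :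
    expect q p (fun x => h (x i)) = ∑ m, exoProb q p m * h m := by
  have key := expect_prod_coord (n := n) (q := q) (p := p)
    (fun j m => if j = i then h m else 1)
  rw [prod_eq_single i] at key
  · simp only [if_true] at key
    rw [← key]
    congr 1
    ext x
    rw [prod_eq_single i] <;> simp +contextual
  · intro j _ hj
    simp [hj, sum_exoProb]
  · simp

/-- Functions of disjoint sets of coordinates are uncorrelated. In the double sum over two
independent copies `x`, `y`, exchanging the coordinates outside `A` preserves the weight and turns
`F x * G y` into `F z * G z` with `z = A.piecewise x y`. -/
lemma expect_mul_of_dependsOn (A : Finset (Fin n)) {F G : (Fin n → Fin 3) → ℝ}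
    (hF : DependsOn F (A : Set (Fin n))) (hG : DependsOn G ((A : Set (Fin n))ᶜ)) :
    expect q p (fun x => F x * G x) = expect q p F * expect q p G := by
  let σ : ((Fin n → Fin 3) × (Fin n → Fin 3)) → ((Fin n → Fin 3) × (Fin n → Fin 3)) :=
    fun z => (A.piecewise z.1 z.2, A.piecewise z.2 z.1)
  have hσ : Function.Involutive σ := by
    rintro ⟨x, y⟩
    ext i <;> by_cases hi : i ∈ A <;> simp [σ, hi]
  let w : (Fin n → Fin 3) → ℝ := fun x => ∏ i, exoProb q p (x i)
  have hw : ∀ z, w (σ z).1 * w (σ z).2 = w z.1 * w z.2 := by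
    rintro ⟨x, y⟩
    simp only [w, ← prod_mul_distrib]
    refine prod_congr rfl fun i _ => ?_
    by_cases hi : i ∈ A <;> simp [σ, hi, mul_comm]
  have h1 : expect q p F * expect q p G
      = ∑ z : (Fin n → Fin 3) × (Fin n → Fin 3), w z.1 * w z.2 * (F z.1 * G z.2) := by
    unfold expect
    rw [Fintype.sum_mul_sum, Fintype.sum_prod_type]
    refine sum_congr rfl fun x _ => sum_congr rfl fun y _ => ?_
    simp only [w]; ring
  have h2 : expect q p (fun x => F x * G x)
      = ∑ z : (Fin n → Fin 3) × (Fin n → Fin 3), w z.1 * w z.2 * (F z.1 * G z.1) := by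
    have hone : expect q p (fun _ : Fin n → Fin 3 => (1 : ℝ)) = 1 := expect_const 1
    rw [← mul_one (expect q p _), ← hone]
    unfold expect
    rw [Fintype.sum_mul_sum, Fintype.sum_prod_type]
    refine sum_congr rfl fun x _ => sum_congr rfl fun y _ => ?_
    simp only [w]; ring
  rw [h1, h2, ← (Equiv.sum_comp (Function.Involutive.toPerm σ hσ) _)]
  refine sum_congr rfl fun z _ => ?_
  simp only [Function.Involutive.coe_toPerm]
  rw [hw]
  congr 2
  · refine hF fun i hi => ?_
    simp only [σ]
    rw [piecewise_eq_of_mem _ _ _ (by simpa using hi)]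
  · refine hG fun i hi => ?_
    simp only [σ]
    rw [piecewise_eq_of_notMem _ _ _ (by simpa using hi)]

lemma dependsOn_prod {ι : Type*} {s : Finset ι} {F : ι → (Fin n → Fin 3) → ℝ}
    {A : Set (Fin n)} (h : ∀ k ∈ s, DependsOn (F k) A) :
    DependsOn (fun x => ∏ k ∈ s, F k x) A :=
  fun _ _ hxy => prod_congr rfl fun k hk => h k hk hxy

lemma expect_prod_of_dependsOn {ι : Type*} [DecidableEq ι] (s : Finset ι)
    (F : ι → (Fin n → Fin 3) → ℝ) (A : ι → Finset (Fin n))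
    (hF : ∀ k ∈ s, DependsOn (F k) (A k : Set (Fin n)))
    (hA : (s : Set ι).PairwiseDisjoint A) :
    expect q p (fun x => ∏ k ∈ s, F k x) = ∏ k ∈ s, expect q p (F k) := by
  induction s using Finset.induction_on with
  | empty => simp [expect_const]
  | insert a s ha ih =>
    simp only [prod_insert ha]
    rw [expect_mul_of_dependsOn (A a) (hF a (mem_insert_self _ _)),
      ih (fun k hk => hF k (mem_insert_of_mem hk)) (hA.subset (by simp))]
    refine dependsOn_prod fun k hk => (hF k (mem_insert_of_mem hk)).mono ?_
    have hne : k ≠ a := fun h => ha (h ▸ hk)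
    have := hA (by simp [hk]) (by simp) hne
    intro x hx hxa
    exact (Finset.disjoint_left.mp this) (by simpa using hx) (by simpa using hxa)

/-- The Harris inequality: antitone functions with values in `[0, 1]` are positively correlated.
It is the FKG inequality for the complements `1 - F` and `1 - G`. -/
lemma expect_mul_le_of_antitone (hq : 0 < q) (hp : 0 < p) (hpq : p + q ≤ 1)
    {F G : (Fin n → Fin 3) → ℝ} (hF : Antitone F) (hG : Antitone G)
    (hF1 : ∀ x, F x ≤ 1) (hG1 : ∀ x, G x ≤ 1) :
    expect q p F * expect q p G ≤ expect q p (fun x => F x * G x) := by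
  have key := fkg (fun x => 1 - F x) (fun x => 1 - G x)
    (fun x : Fin n → Fin 3 => ∏ i, exoProb q p (x i))
    (fun x => prod_exoProb_nonneg hq hp hpq x)
    (fun x => sub_nonneg.2 (hF1 x)) (fun x => sub_nonneg.2 (hG1 x))
    (fun x y h => sub_le_sub_left (hF h) 1) (fun x y h => sub_le_sub_left (hG h) 1)
    (fun a b => by
      -- the weight is a product over chains, so log-supermodularity is an equality
      rw [← prod_mul_distrib, ← prod_mul_distrib]
      refine le_of_eq (prod_congr rfl fun i _ => ?_)
      rcases le_total (a i) (b i) with h | h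
      · simp [h]
      · simp [h, mul_comm])
  change expect q p (fun x => 1 - F x) * expect q p (fun x => 1 - G x)
    ≤ _ * expect q p (fun x => (1 - F x) * (1 - G x)) at key
  have hone : ∑ x : Fin n → Fin 3, ∏ i, exoProb q p (x i) = 1 := by
    simpa [expect] using expect_const (n := n) (q := q) (p := p) 1
  have hmul : (fun x => (1 - F x) * (1 - G x)) = fun x => (1 - F x) - (G x - F x * G x) := by
    ext x; ring
  rw [hone, hmul] at key
  simp only [expect_sub, expect_const] at key
  linarith

lemma prod_expect_le_of_antitone (hq : 0 < q) (hp : 0 < p) (hpq : p + q ≤ 1)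
    {ι : Type*} [DecidableEq ι] (s : Finset ι) (F : ι → (Fin n → Fin 3) → ℝ)
    (hF : ∀ k ∈ s, Antitone (F k)) (hF0 : ∀ k ∈ s, ∀ x, 0 ≤ F k x)
    (hF1 : ∀ k ∈ s, ∀ x, F k x ≤ 1) :
    ∏ k ∈ s, expect q p (F k) ≤ expect q p (fun x => ∏ k ∈ s, F k x) := by
  induction s using Finset.induction_on with
  | empty => simp [expect_const]
  | insert a s ha ih =>
    simp only [forall_mem_insert] at hF hF0 hF1
    simp only [prod_insert ha]
    have h0 : 0 ≤ expect q p (F a) := by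
      have := expect_mono hq hp hpq (hF0.1)
      rwa [expect_const] at this
    refine (mul_le_mul_of_nonneg_left (ih hF.2 hF0.2 hF1.2) h0).trans ?_
    refine expect_mul_le_of_antitone hq hp hpq hF.1 ?_ hF1.1 ?_
    · intro x y hxy
      exact prod_le_prod (fun k hk => hF0.2 k hk y) fun k hk => hF.2 k hk hxy
    · intro x
      exact prod_le_one (fun k hk => hF0.2 k hk x) fun k hk => hF1.2 k hk x

/-- The second moment of a sum of independent centred terms is at most linear in their number. -/
lemma expect_sum_sq_le (hq : 0 < q) (hp : 0 < p) (hpq : p + q ≤ 1) (s : Finset (Fin n))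
    (h : Fin 3 → ℝ) (hmean : ∑ m, exoProb q p m * h m = 0) {C : ℝ} (hC : ∀ m, h m ^ 2 ≤ C) :
    expect q p (fun x => (∑ j ∈ s, h (x j)) ^ 2) ≤ s.card * C := by
  have h1 : ∀ x : Fin n → Fin 3, (∑ j ∈ s, h (x j)) ^ 2
      = ∑ j ∈ s, ∑ k ∈ s, h (x j) * h (x k) := fun x => by rw [sq, sum_mul_sum]
  simp only [h1, expect_sum]
  have h2 : ∀ j ∈ s, ∑ k ∈ s, expect q p (fun x : Fin n → Fin 3 => h (x j) * h (x k)) ≤ C := by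
    intro j hj
    rw [sum_eq_single j]
    · have := expect_mono (n := n) hq hp hpq (F := fun x => h (x j) * h (x j)) (G := fun _ => C)
        (fun x => by simpa [sq] using hC (x j))
      rwa [expect_const] at this
    · intro k _ hk
      rw [expect_mul_of_dependsOn {j} (F := fun x => h (x j)) (G := fun x => h (x k)),
        expect_coord, hmean, zero_mul]
      · intro x y hxy; simp [hxy j (by simp)]
      · intro x y hxy; simp [hxy k (by simpa using hk)]
    · exact fun hj' => absurd hj hj'
  exact (sum_le_sum h2).trans (by simp)

/-- The mean of `1 / (1 + Z)` for a binomial variable `Z`, by integrating the probability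
generating function `𝔼[t ^ Z] = (1 - q + q t) ^ m` over `t ∈ [0, 1]`. -/
lemma expect_inv_one_add_card (hq : 0 < q) (s : Finset (Fin n)) :
    expect q p (fun x => 1 / (1 + (#{l ∈ s | x l = 0} : ℝ)))
      = (1 - (1 - q) ^ (s.card + 1)) / ((s.card + 1 : ℕ) * q) := by
  have hgen : ∀ t : ℝ, expect q p (fun x => t ^ #{l ∈ s | x l = 0})
      = (1 - q + q * t) ^ s.card := by
    intro t
    have h := expect_prod_coord (n := n) (q := q) (p := p)
      (fun i m => if i ∈ s ∧ m = 0 then t else 1)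
    have h3 : ∀ i : Fin n, ∑ m, exoProb q p m * (if i ∈ s ∧ m = 0 then t else 1)
        = if i ∈ s then 1 - q + q * t else 1 := by
      intro i
      rw [sum_exoProb_mul]
      by_cases hi : i ∈ s
      · simp [hi]
        ring
      · simp [hi]
    simp only [h3, prod_ite_mem, univ_inter, prod_const] at h
    rw [← h]
    congr 1
    ext x
    rw [← prod_const, prod_filter, ← prod_subset (subset_univ s)]
    · exact prod_congr rfl fun i hi => by simp [hi]
    · intro i _ hi; simp [hi]
  have hint : ∀ x : Fin n → Fin 3, 1 / (1 + (#{l ∈ s | x l = 0} : ℝ))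
      = ∫ t in (0 : ℝ)..1, t ^ #{l ∈ s | x l = 0} := by
    intro x
    rw [integral_pow]; simp [add_comm]
  have hswap : expect q p (fun x => ∫ t in (0 : ℝ)..1, t ^ #{l ∈ s | x l = 0})
      = ∫ t in (0 : ℝ)..1, expect q p (fun x => t ^ #{l ∈ s | x l = 0}) := by
    unfold expect
    rw [intervalIntegral.integral_finsetSum]
    · exact sum_congr rfl fun x _ => by rw [intervalIntegral.integral_const_mul]
    · intro x _
      exact (Continuous.intervalIntegrable (by fun_prop) _ _)
  simp only [hint]
  rw [hswap]
  simp only [hgen]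
  have := intervalIntegral.integral_comp_add_mul (a := 0) (b := 1)
    (fun u : ℝ => u ^ s.card) hq.ne' (1 - q)
  rw [this, integral_pow]
  simp only [smul_eq_mul, mul_one, mul_zero, add_zero, sub_add_cancel, one_pow]
  have : (s.card + 1 : ℝ) ≠ 0 := by positivity
  push_cast
  field_simp

end Expect

/-! ### A product formula for the utility -/

/-- The conditional probability, given the exogenous opportunities `x`, that `k` does not pass an
opportunity to its neighbour `i`, when `i` has none. The needy neighbours of `k` are counted as `i`
plus those other than `i`, so that the value does not depend on `x i`. -/
noncomputable def missProb {n : ℕ} (E : SimpleGraph (Fin n)) (i k : Fin n)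
    (x : Fin n → Fin 3) : ℝ :=
  1 - if x k = 2 then 1 / (1 + (#{l ∈ (nbrs E k).erase i | x l = 0} : ℝ)) else 0

section Utility

variable {n : ℕ} {q p : ℝ} {E : SimpleGraph (Fin n)}

@[simp] lemma mem_nbrs {i j : Fin n} : j ∈ nbrs E i ↔ E.Adj i j := by
  simp [nbrs]

lemma missProb_nonneg (i k : Fin n) (x : Fin n → Fin 3) : 0 ≤ missProb E i k x := by
  unfold missProb
  split_ifs
  · rw [sub_nonneg, div_le_one (by positivity)]
    simp
  · simp

lemma missProb_le_one (i k : Fin n) (x : Fin n → Fin 3) : missProb E i k x ≤ 1 := by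
  unfold missProb
  split_ifs
  · have : 0 ≤ 1 / (1 + (#{l ∈ (nbrs E k).erase i | x l = 0} : ℝ)) := by positivity
    linarith
  · simp

/-- Raising the number of opportunities of anyone makes it more likely that `i` is helped: donors
become more numerous and competitors fewer. -/
lemma missProb_antitone (i k : Fin n) : Antitone (missProb E i k) := by
  intro x y hxy
  by_cases hx : x k = 2
  · have hy : y k = 2 := by
      have := hxy k
      rw [hx] at this
      exact le_antisymm (Fin.le_last _) this
    simp only [missProb, hx, hy, if_true]
    have hsub : ({l ∈ (nbrs E k).erase i | y l = 0} : Finset (Fin n))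
        ⊆ ({l ∈ (nbrs E k).erase i | x l = 0} : Finset (Fin n)) := by
      intro l hl
      simp only [mem_filter] at hl ⊢
      refine ⟨hl.1, le_antisymm ?_ (Fin.zero_le _)⟩
      rw [← hl.2]; exact hxy l
    have : (#{l ∈ (nbrs E k).erase i | y l = 0} : ℝ) ≤ #{l ∈ (nbrs E k).erase i | x l = 0} := by
      exact_mod_cast card_le_card hsub
    gcongr
  · have : missProb E i k x = 1 := by simp [missProb, hx]
    rw [this]
    exact missProb_le_one i k y

lemma missProb_dependsOn (i k : Fin n) :
    DependsOn (missProb E i k)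
      ((insert k ((nbrs E k).erase i) : Finset (Fin n)) : Set (Fin n)) := by
  intro x y hxy
  simp only [coe_insert, coe_erase, Set.mem_insert_iff] at hxy
  have hf : ({l ∈ (nbrs E k).erase i | x l = 0} : Finset (Fin n))
      = ({l ∈ (nbrs E k).erase i | y l = 0} : Finset (Fin n)) := by
    refine filter_congr fun l hl => ?_
    rw [hxy l (Or.inr (by simpa [and_comm] using hl))]
  simp only [missProb, hf, hxy k (Or.inl rfl)]

lemma expect_missProb (hq : 0 < q) {i k : Fin n} (h : E.Adj i k) :
    expect q p (missProb E i k)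
      = 1 - p / q * ((1 - (1 - q) ^ #(nbrs E k)) / (#(nbrs E k) : ℝ)) := by
  have hmul : ∀ x, missProb E i k x = 1 - (if x k = 2 then (1 : ℝ) else 0)
      * (1 / (1 + (#{l ∈ (nbrs E k).erase i | x l = 0} : ℝ))) := by
    intro x
    simp only [missProb, ite_mul, one_mul, zero_mul]
  have hcard : #((nbrs E k).erase i) + 1 = #(nbrs E k) :=
    card_erase_add_one (by simpa using h.symm)
  have hpos : (0 : ℝ) < #(nbrs E k) := by
    rw [← hcard]; positivity
  rw [funext hmul, expect_sub, expect_const, expect_mul_of_dependsOn {k},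
    expect_coord k (fun m => if m = 2 then (1 : ℝ) else 0), sum_exoProb_mul,
    expect_inv_one_add_card hq, hcard]
  · simp only [Fin.reduceEq, if_false, if_true]
    field_simp
    ring
  · intro x y hxy; simp [hxy k (by simp)]
  · intro x y hxy
    have hf : ({l ∈ (nbrs E k).erase i | x l = 0} : Finset (Fin n))
        = ({l ∈ (nbrs E k).erase i | y l = 0} : Finset (Fin n)) := by
      refine filter_congr fun l hl => ?_
      have hlk : l ≠ k := by
        rintro rfl
        simp at hl
      rw [hxy l (by simpa using hlk)]
    simp only [hf]

lemma sum_transferProb (x : Fin n → Fin 3) (j : Fin n) :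
    ∑ r, transferProb E x j r = 1 := by
  unfold transferProb
  rw [Fintype.sum_option]
  by_cases h : x j = 2 ∧ (needy E x j).Nonempty
  · have : (#(needy E x j) : ℝ) ≠ 0 := by
      exact_mod_cast (card_pos.2 h.2).ne'
    simp [h, this]
  · simp [h]

lemma sum_transferProb_ne {x : Fin n → Fin 3} {i j : Fin n} (h : E.Adj i j) (hx : x i = 0) :
    ∑ r, transferProb E x j r * (if r = some i then 0 else 1) = missProb E i j x := by
  have h1 : ∑ r, transferProb E x j r * (if r = some i then 0 else 1)
      = 1 - transferProb E x j (some i) := by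
    have h2 : ∀ r, transferProb E x j r * (if r = some i then 0 else 1)
        = transferProb E x j r - if r = some i then transferProb E x j r else 0 := by
      intro r
      split_ifs <;> simp
    simp only [h2, sum_sub_distrib, sum_transferProb, sum_ite_eq', mem_univ, if_true]
  have hi : i ∈ needy E x j := by simp [needy, h.symm, hx]
  have hcard : #(needy E x j) = #{l ∈ (nbrs E j).erase i | x l = 0} + 1 := by
    rw [← card_erase_add_one hi]
    congr 2
    ext l
    simp [needy, and_assoc]
  rw [h1, missProb]
  congr 1
  unfold transferProb
  have hne : (needy E x j).Nonempty := ⟨i, hi⟩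
  by_cases h2 : x j = 2
  · simp only [h2, hne, and_self, if_true, Option.elim, hi, hcard]
    push_cast
    rw [add_comm]
  · simp [h2]

lemma payoff_zero_eq (ω : Outcome n) (i : Fin n) :
    payoff 0 E ω i = 1 - if ω.1 i = 0
      then ∏ j, (if j ∈ nbrs E i ∧ ω.2 j = some i then (0 : ℝ) else 1) else 0 := by
  unfold payoff
  rw [zero_mul, sub_zero]
  by_cases h0 : ω.1 i = 0
  · by_cases hex : ∃ j, j ∈ nbrs E i ∧ ω.2 j = some i
    · obtain ⟨j, hj⟩ := hex
      have hz : ∏ j, (if j ∈ nbrs E i ∧ ω.2 j = some i then (0 : ℝ) else 1) = 0 :=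
        prod_eq_zero (mem_univ j) (if_pos hj)
      rw [if_pos h0, hz]
      have h1 : 1 ≤ ∑ j ∈ nbrs E i, passes ω j i := by
        have := single_le_sum (f := fun j => passes ω j i) (fun _ _ => Nat.zero_le _)
          hj.1
        simpa [passes, hj.2] using this
      rw [min_eq_left (by omega)]
      simp
    · push Not at hex
      rw [if_pos h0, prod_eq_one (fun j _ => if_neg fun h => hex j h.1 h.2)]
      have h1 : ∑ j ∈ nbrs E i, passes ω j i = 0 :=
        sum_eq_zero fun j hj => by simp [passes, hex j hj]
      simp [h0, h1]
  · have : 1 ≤ (ω.1 i : ℕ) := Nat.one_le_iff_ne_zero.2 fun h => h0 (Fin.ext h)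
    rw [if_neg h0, min_eq_left (by omega)]
    simp

lemma sum_prod_transferProb (x : Fin n → Fin 3) :
    ∑ r : Fin n → Option (Fin n), ∏ j, transferProb E x j (r j) = 1 := by
  rw [← Fintype.prod_sum]
  exact prod_eq_one fun j _ => sum_transferProb x j

/-- Without link costs, `i` fails to get an opportunity exactly when it has none itself and all its
neighbours miss it; given the exogenous opportunities these misses are independent. -/
lemma utility_eq (i : Fin n) :
    utility q p 0 E i = 1 - q * expect q p (fun x => ∏ k ∈ nbrs E i, missProb E i k x) := by
  have hinner : ∀ x : Fin n → Fin 3,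
      ∑ r : Fin n → Option (Fin n), (∏ j, transferProb E x j (r j)) * payoff 0 E (x, r) i
        = 1 - (if x i = 0 then 1 else 0) * ∏ k ∈ nbrs E i, missProb E i k x := by
    intro x
    simp only [payoff_zero_eq, mul_sub, mul_one, sum_sub_distrib, sum_prod_transferProb]
    by_cases h0 : x i = 0
    · simp only [h0, if_true, one_mul]
      congr 1
      simp only [← prod_mul_distrib]
      rw [← Fintype.prod_sum (fun j r => transferProb E x j r
        * if j ∈ nbrs E i ∧ r = some i then (0 : ℝ) else 1)]
      rw [← prod_subset (subset_univ (nbrs E i))]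
      · refine prod_congr rfl fun j hj => ?_
        simp only [hj, true_and]
        exact sum_transferProb_ne (mem_nbrs.1 hj) h0
      · intro j _ hj
        simp only [hj, false_and, if_false, mul_one, sum_transferProb]
    · simp [h0]
  have hmain : utility q p 0 E i = expect q p (fun x => 1 - (if x i = 0 then 1 else 0)
      * ∏ k ∈ nbrs E i, missProb E i k x) := by
    unfold utility expect
    rw [Fintype.sum_prod_type]
    refine sum_congr rfl fun x _ => ?_
    dsimp only
    rw [← hinner x, mul_sum]
    refine sum_congr rfl fun r _ => ?_
    simp only [outcomeProb]
    ring
  rw [hmain, expect_sub, expect_const, expect_mul_of_dependsOn {i},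
    expect_coord i (fun m => if m = 0 then (1 : ℝ) else 0), sum_exoProb_mul]
  · simp
  · intro x y hxy; simp [hxy i (by simp)]
  · refine dependsOn_prod fun k hk => ?_
    have hki : k ≠ i := (mem_nbrs.1 hk).ne'
    refine (missProb_dependsOn i k).mono ?_
    intro l hl
    simp only [coe_insert, Set.mem_insert_iff, mem_coe, mem_erase] at hl
    rcases hl with rfl | hl
    · simpa using hki
    · simpa using hl.1

end Utility

/-! ### Equilibria -/

section Equilibria

variable {n : ℕ} {q p : ℝ} {E E' : SimpleGraph (Fin n)}

/-- A new neighbour strictly helps `i`: the other neighbours of `i` miss it with the same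
probability as before, and the new one passes with positive probability. -/
lemma utility_lt_of_new_neighbor (hq : 0 < q) (hp : 0 < p) (hpq : p + q ≤ 1) {i j : Fin n}
    (hij : ¬ E.Adj i j) (hnbrs : nbrs E' i = insert j (nbrs E i))
    (hmiss : ∀ k ∈ nbrs E i, (nbrs E' k).erase i = (nbrs E k).erase i) :
    utility q p 0 E i < utility q p 0 E' i := by
  rw [utility_eq, utility_eq, hnbrs]
  have hj : j ∉ nbrs E i := by simpa using hij
  have hprod : ∀ x, ∏ k ∈ insert j (nbrs E i), missProb E' i k x
      = missProb E' i j x * ∏ k ∈ nbrs E i, missProb E i k x := by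
    intro x
    rw [prod_insert hj]
    congr 1
    exact prod_congr rfl fun k hk => by simp only [missProb, hmiss k hk]
  have hnn : ∀ x, 0 ≤ ∏ k ∈ nbrs E i, missProb E i k x := fun x =>
    prod_nonneg fun k _ => missProb_nonneg i k x
  refine sub_lt_sub_left (mul_lt_mul_of_pos_left ?_ hq) 1
  simp only [hprod]
  unfold expect
  refine sum_lt_sum (fun x _ => mul_le_mul_of_nonneg_left ?_ (prod_exoProb_nonneg hq hp hpq x))
    ⟨fun l => if l = j then 2 else 0, mem_univ _, ?_⟩
  · exact mul_le_of_le_one_left (hnn x) (missProb_le_one i j x)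
  -- when `j` is the only donor, nobody but the new neighbour can help `i`
  · refine mul_lt_mul_of_pos_left ?_ (prod_pos fun l _ => ?_)
    · have h1 : ∏ k ∈ nbrs E i, missProb E i k (fun l => if l = j then 2 else 0) = 1 := by
        refine prod_eq_one fun k hk => ?_
        have hkj : k ≠ j := fun h => hj (h ▸ hk)
        simp [missProb, hkj]
      dsimp only
      rw [h1, mul_one]
      simp only [missProb, if_true]
      rw [sub_lt_self_iff]
      positivity
    · by_cases h : l = j <;> simp [exoProb, h, hq, hp]

lemma utility_lt_of_deleted (hq : 0 < q) (hp : 0 < p) (hpq : p + q ≤ 1) {i j : Fin n}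
    (hij : E.Adj i j) :
    utility q p 0 (E.deleteEdges {s(i, j)}) i < utility q p 0 E i := by
  have hne := hij.ne
  refine utility_lt_of_new_neighbor (j := j) hq hp hpq (by simp) ?_ ?_
  · ext l
    simp only [mem_insert, mem_nbrs, SimpleGraph.deleteEdges_adj, Set.mem_singleton_iff,
      Sym2.eq_iff]
    constructor
    · intro h
      by_cases hl : l = j
      · exact Or.inl hl
      · exact Or.inr ⟨h, by rintro (⟨-, h⟩ | ⟨h, -⟩); exacts [hl h, hne h]⟩
    · rintro (rfl | h)
      exacts [hij, h.1]
  · intro k hk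
    simp only [mem_nbrs, SimpleGraph.deleteEdges_adj, Set.mem_singleton_iff, Sym2.eq_iff] at hk
    have hkj : k ≠ j := by
      rintro rfl; simp at hk
    have hki : k ≠ i := by
      rintro rfl; simp at hk
    ext l
    simp [SimpleGraph.deleteEdges_adj, hkj, hki]

lemma addDrop_empty (i j : Fin n) : addDrop E i j ∅ = E ⊔ SimpleGraph.edge i j := by
  simp [addDrop]

lemma utility_lt_addDrop_empty (hq : 0 < q) (hp : 0 < p) (hpq : p + q ≤ 1) {i j : Fin n}
    (hne : i ≠ j) (hij : ¬ E.Adj i j) :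
    utility q p 0 E i < utility q p 0 (addDrop E i j ∅) i := by
  have hadj : (addDrop E i j ∅).Adj i j := by
    simp [addDrop_empty, SimpleGraph.edge_adj, hne]
  have hdel : (addDrop E i j ∅).deleteEdges {s(i, j)} = E := by
    ext a b
    rw [addDrop_empty]
    simp only [SimpleGraph.deleteEdges_adj, SimpleGraph.sup_adj, SimpleGraph.edge_adj,
      Set.mem_singleton_iff, Sym2.eq_iff]
    constructor
    · rintro ⟨h | h, h'⟩
      · exact h
      · exact absurd h.1 (by tauto)
    · intro h
      refine ⟨Or.inl h, ?_⟩
      rintro (⟨rfl, rfl⟩ | ⟨rfl, rfl⟩)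
      exacts [hij h, hij h.symm]
  have := utility_lt_of_deleted hq hp hpq hadj
  rwa [hdel] at this

/-- Links being free and strictly profitable, the complete network is the only equilibrium. -/
lemma isDFPNE_iff_eq_top (hq : 0 < q) (hp : 0 < p) (hpq : p + q ≤ 1) :
    IsDFPNE q p 0 E ↔ E = ⊤ := by
  constructor
  · rintro ⟨h, -⟩
    ext i j
    simp only [SimpleGraph.top_adj]
    refine ⟨fun h => h.ne, fun hne => ?_⟩
    by_contra hij
    rcases h i j hne hij ∅ ∅ (Set.empty_subset _) (Set.empty_subset _) with h | h
    · exact absurd h (not_le.2 (utility_lt_addDrop_empty hq hp hpq hne hij))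
    · exact absurd h (not_le.2 (utility_lt_addDrop_empty hq hp hpq hne.symm fun h => hij h.symm))
  · rintro rfl
    refine ⟨fun i j hne hij => absurd hne hij, fun i j hij => ?_⟩
    refine ⟨(utility_lt_of_deleted hq hp hpq hij).le, ?_⟩
    rw [Sym2.eq_swap]
    exact (utility_lt_of_deleted hq hp hpq hij.symm).le

lemma PoA_eq (hq : 0 < q) (hp : 0 < p) (hpq : p + q ≤ 1) :
    PoA n q p 0 = (⨆ E : SimpleGraph (Fin n), welfare q p 0 E)
      / welfare q p 0 (⊤ : SimpleGraph (Fin n)) := by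
  have : {E : SimpleGraph (Fin n) | IsDFPNE q p 0 E} = {⊤} := by
    ext E; simp [isDFPNE_iff_eq_top hq hp hpq]
  rw [PoA, this, Set.image_singleton, csInf_singleton]

end Equilibria

/-! ### The upper bound on welfare -/

/-- The probability that a neighbour of degree `d` fails to pass an opportunity to a given needy
individual; it equals `1` for `d = 0`. -/
noncomputable def missMean (q p : ℝ) (d : ℕ) : ℝ :=
  1 - p / q * ((1 - (1 - q) ^ d) / (d : ℝ))

/-- The expected utility of an individual in a `d`-regular tree. -/
noncomputable def treeUtility (q p : ℝ) (d : ℕ) : ℝ :=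
  1 - q * missMean q p d ^ d

section UpperBound

variable {n : ℕ} {q p : ℝ}

lemma missMean_le_one (hq : 0 < q) (hp : 0 < p) (hpq : p + q ≤ 1) (d : ℕ) :
    missMean q p d ≤ 1 := by
  have : (1 - q) ^ d ≤ 1 := pow_le_one₀ (by linarith) (by linarith)
  have : 0 ≤ p / q * ((1 - (1 - q) ^ d) / (d : ℝ)) :=
    mul_nonneg (by positivity) (div_nonneg (by linarith) (by positivity))
  unfold missMean
  linarith

lemma missMean_pos (hq : 0 < q) (hp : 0 < p) (hpq : p + q ≤ 1) (d : ℕ) :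
    0 < missMean q p d := by
  have hb : 1 - (1 - q) ^ d ≤ d * q := by
    have := one_add_mul_le_pow (a := -q) (by linarith) d
    rw [← sub_eq_add_neg 1 q] at this
    linarith
  have h1 : (1 - (1 - q) ^ d) / (d : ℝ) ≤ q := by
    refine div_le_of_le_mul₀ (by positivity) hq.le ?_
    linarith
  have h2 : p / q * ((1 - (1 - q) ^ d) / (d : ℝ)) ≤ p := by
    calc p / q * ((1 - (1 - q) ^ d) / (d : ℝ)) ≤ p / q * q := by gcongr
      _ = p := by field_simp
  unfold missMean
  linarith

lemma treeUtility_nonneg (hq : 0 < q) (hp : 0 < p) (hpq : p + q ≤ 1) (d : ℕ) :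
    0 ≤ treeUtility q p d := by
  have h := pow_le_one₀ (n := d) (missMean_pos hq hp hpq d).le (missMean_le_one hq hp hpq d)
  have : q * missMean q p d ^ d ≤ q := mul_le_of_le_one_right hq.le h
  unfold treeUtility
  linarith

lemma treeUtility_le_one (hq : 0 < q) (hp : 0 < p) (hpq : p + q ≤ 1) (d : ℕ) :
    treeUtility q p d ≤ 1 := by
  have := mul_nonneg hq.le (pow_nonneg (missMean_pos hq hp hpq d).le d)
  unfold treeUtility
  linarith

lemma utility_nonneg (hq : 0 < q) (hp : 0 < p) (hpq : p + q ≤ 1) (E : SimpleGraph (Fin n))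
    (i : Fin n) : 0 ≤ utility q p 0 E i := by
  have h : expect q p (fun x => ∏ k ∈ nbrs E i, missProb E i k x) ≤ 1 := by
    refine (expect_mono hq hp hpq (G := fun _ => 1) fun x => ?_).trans_eq (expect_const 1)
    exact prod_le_one (fun k _ => missProb_nonneg i k x) fun k _ => missProb_le_one i k x
  have : q * expect q p (fun x => ∏ k ∈ nbrs E i, missProb E i k x) ≤ q :=
    mul_le_of_le_one_right hq.le h
  rw [utility_eq]
  linarith

/-- By the Harris inequality, shared neighbours and cycles can only hurt: the utility is at most
what it would be if the neighbours of `i` acted independently. -/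
lemma utility_le (hq : 0 < q) (hp : 0 < p) (hpq : p + q ≤ 1) (E : SimpleGraph (Fin n))
    (i : Fin n) :
    utility q p 0 E i ≤ 1 - q * ∏ k ∈ nbrs E i, missMean q p #(nbrs E k) := by
  rw [utility_eq]
  refine sub_le_sub_left (mul_le_mul_of_nonneg_left ?_ hq.le) 1
  refine (prod_congr rfl fun k hk => ?_).trans_le
    (prod_expect_le_of_antitone hq hp hpq (nbrs E i) (fun k => missProb E i k)
      (fun k _ => missProb_antitone i k) (fun k _ x => missProb_nonneg i k x)
      fun k _ x => missProb_le_one i k x)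
  rw [expect_missProb hq (mem_nbrs.1 hk), missMean]

lemma card_mul_le_sum_of_pow_le_prod {ι : Type*} (s : Finset ι) (z : ι → ℝ) {c : ℝ}
    (hc : 0 ≤ c) (hz : ∀ i ∈ s, 0 ≤ z i) (h : c ^ #s ≤ ∏ i ∈ s, z i) :
    #s * c ≤ ∑ i ∈ s, z i := by
  rcases s.eq_empty_or_nonempty with rfl | hs
  · simp
  have hcard : (0 : ℝ) < #s := by exact_mod_cast hs.card_pos
  have key := Real.geom_mean_le_arith_mean s (fun _ => 1) z (by simp) (by simpa using hcard) hz
  simp only [Real.rpow_one, sum_const, nsmul_eq_mul, mul_one, one_mul] at key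
  rw [le_div_iff₀ hcard] at key
  have h2 : c ≤ (∏ i ∈ s, z i) ^ (#s : ℝ)⁻¹ := by
    rw [Real.le_rpow_inv_iff_of_pos hc (prod_nonneg hz) hcard, Real.rpow_natCast]
    exact h
  nlinarith

/-- In the product over all `i` of the bounds of `utility_le`, an individual `k` of degree `d`
contributes `missMean q p d ^ d`; the inequality of arithmetic and geometric means concludes. -/
lemma welfare_le (hq : 0 < q) (hp : 0 < p) (hpq : p + q ≤ 1) (E : SimpleGraph (Fin n)) {M : ℝ}
    (hM : ∀ d ≤ n, treeUtility q p d ≤ M) : welfare q p 0 E ≤ n * M := by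
  have hM' : ∀ d ≤ n, (1 - M) / q ≤ missMean q p d ^ d := by
    intro d hd
    have := hM d hd
    rw [treeUtility] at this
    rw [div_le_iff₀ hq]
    linarith
  have hpos : ∀ i, 0 ≤ ∏ k ∈ nbrs E i, missMean q p #(nbrs E k) := fun i =>
    prod_nonneg fun k _ => (missMean_pos hq hp hpq _).le
  have hsum : n * ((1 - M) / q) ≤ ∑ i, ∏ k ∈ nbrs E i, missMean q p #(nbrs E k) := by
    rcases le_total ((1 - M) / q) 0 with h0 | h0
    · exact (mul_nonpos_of_nonneg_of_nonpos (by positivity) h0).trans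
        (sum_nonneg fun i _ => hpos i)
    · have hprod : ∏ i, ∏ k ∈ nbrs E i, missMean q p #(nbrs E k)
          = ∏ k, missMean q p #(nbrs E k) ^ #(nbrs E k) := by
        rw [prod_comm' (t' := univ) (s' := fun k => nbrs E k)
          (by intro x y; simp [E.adj_comm])]
        exact prod_congr rfl fun k _ => by rw [prod_const]
      have := card_mul_le_sum_of_pow_le_prod univ
        (fun i => ∏ k ∈ nbrs E i, missMean q p #(nbrs E k)) h0 (fun i _ => hpos i) (by
          rw [hprod, ← prod_const]
          refine prod_le_prod (fun _ _ => h0) fun k _ => hM' _ ?_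
          simpa using card_le_univ (nbrs E k))
      simpa using this
  have h1 : welfare q p 0 E ≤ ∑ i, (1 - q * ∏ k ∈ nbrs E i, missMean q p #(nbrs E k)) :=
    sum_le_sum fun i _ => utility_le hq hp hpq E i
  rw [sum_sub_distrib, ← mul_sum] at h1
  have h2 := mul_le_mul_of_nonneg_left hsum hq.le
  have h3 : q * (n * ((1 - M) / q)) = n * (1 - M) := by field_simp
  simp only [sum_const, card_univ, Fintype.card_fin, nsmul_eq_mul, mul_one] at h1
  linarith

end UpperBound

/-! ### Networks that are locally regular trees -/

section Tree

variable {n : ℕ} {q p : ℝ}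

/-- If `i` lies on no cycle of length three or four, its neighbours act independently. -/
lemma utility_eq_treeUtility (hq : 0 < q) {E : SimpleGraph (Fin n)} {i : Fin n} {d : ℕ}
    (hi : #(nbrs E i) = d) (hk : ∀ k, E.Adj i k → #(nbrs E k) = d)
    (h3 : ∀ k k', E.Adj i k → E.Adj i k' → ¬ E.Adj k k')
    (h4 : ∀ k k' l, E.Adj i k → E.Adj i k' → E.Adj k l → E.Adj k' l → k = k' ∨ l = i) :
    utility q p 0 E i = treeUtility q p d := by
  rw [utility_eq, expect_prod_of_dependsOn (nbrs E i) (fun k => missProb E i k)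
    (fun k => insert k ((nbrs E k).erase i)) (fun k _ => missProb_dependsOn i k)]
  · have : ∏ k ∈ nbrs E i, expect q p (missProb E i k) = ∏ k ∈ nbrs E i, missMean q p d := by
      refine prod_congr rfl fun k hk' => ?_
      rw [mem_nbrs] at hk'
      rw [expect_missProb hq hk', hk k hk', missMean]
    rw [this, prod_const, hi, treeUtility]
  · intro k hk k' hk' hne
    simp only [mem_coe, mem_nbrs] at hk hk'
    refine Finset.disjoint_left.2 fun l hl hl' => ?_
    simp only [mem_insert, mem_erase, mem_nbrs] at hl hl'
    rcases hl with rfl | hl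
    · rcases hl' with rfl | hl'
      · exact hne rfl
      · exact h3 _ _ hk' hk hl'.2
    · rcases hl' with rfl | hl'
      · exact h3 _ _ hk hk' hl.2
      · rcases h4 k k' l hk hk' hl.2 hl'.2 with h | h
        exacts [hne h, hl.1 h]

/-- The network linking every even `v` to the odd `v + (2 ^ (k + 1) + 1)`, for `k < d`. It is
bipartite and, a sum of two powers of two determining both of them, has no cycle of length four;
away from the ends of `{0, …, n - 1}` every individual has degree `d`. -/
def powerShiftGraph (n d : ℕ) : SimpleGraph (Fin n) where
  Adj v w := (v.val % 2 = 0 ∧ ∃ k < d, w.val = v.val + (2 ^ (k + 1) + 1)) ∨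
    (w.val % 2 = 0 ∧ ∃ k < d, v.val = w.val + (2 ^ (k + 1) + 1))
  symm := ⟨fun _ _ h => h.symm⟩
  loopless := ⟨fun v h => by
    rcases h with ⟨-, k, -, h⟩ | ⟨-, k, -, h⟩ <;> omega⟩

lemma two_pow_add_two_pow_eq {a b c e : ℕ} (h : 2 ^ a + 2 ^ b = 2 ^ c + 2 ^ e) :
    a = c ∨ a = e := by
  have key : ∀ {a b c e : ℕ}, a ≤ b → c ≤ e → 2 ^ a + 2 ^ b = 2 ^ c + 2 ^ e → b ≤ e := by
    intro a b c e hab hce h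
    by_contra! hlt
    have h1 : 2 ^ c ≤ 2 ^ e := Nat.pow_le_pow_right (by norm_num) hce
    have h2 : 2 ^ (e + 1) ≤ 2 ^ b := Nat.pow_le_pow_right (by norm_num) hlt
    have h3 : 0 < 2 ^ a := by positivity
    rw [pow_succ] at h2
    omega
  have inj : ∀ {a b : ℕ}, 2 ^ a = 2 ^ b → a = b := fun h => Nat.pow_right_injective le_rfl h
  have key2 : ∀ {a b c e : ℕ}, a ≤ b → c ≤ e → 2 ^ a + 2 ^ b = 2 ^ c + 2 ^ e →
      a = c ∧ b = e := by
    intro a b c e hab hce h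
    have hbe : b = e := le_antisymm (key hab hce h) (key hce hab h.symm)
    subst hbe
    exact ⟨inj (by omega), rfl⟩
  rcases le_total a b with h1 | h1 <;> rcases le_total c e with h2 | h2
  · exact Or.inl (key2 h1 h2 h).1
  · exact Or.inr (key2 h1 h2 (by omega)).1
  · exact Or.inr (key2 h1 h2 (by omega)).2
  · exact Or.inl (key2 h1 h2 (by omega)).2

lemma powerShiftGraph_adj_of_even {d : ℕ} {v w : Fin n} (hv : v.val % 2 = 0) :
    (powerShiftGraph n d).Adj v w ↔ ∃ k < d, w.val = v.val + (2 ^ (k + 1) + 1) := by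
  constructor
  · rintro (⟨-, h⟩ | ⟨hw, k, -, h⟩)
    · exact h
    · rw [pow_succ] at h
      omega
  · exact fun h => Or.inl ⟨hv, h⟩

lemma powerShiftGraph_adj_of_odd {d : ℕ} {v w : Fin n} (hv : v.val % 2 = 1) :
    (powerShiftGraph n d).Adj v w ↔ ∃ k < d, v.val = w.val + (2 ^ (k + 1) + 1) := by
  constructor
  · rintro (⟨h0, -⟩ | ⟨-, h⟩)
    · omega
    · exact h
  · rintro ⟨k, hk, h⟩
    refine Or.inr ⟨?_, k, hk, h⟩
    rw [pow_succ] at h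
    omega

lemma powerShiftGraph_parity {d : ℕ} {v w : Fin n} (h : (powerShiftGraph n d).Adj v w) :
    (v.val + w.val) % 2 = 1 := by
  rcases h with ⟨h0, k, -, h⟩ | ⟨h0, k, -, h⟩ <;> rw [pow_succ] at h <;> omega

lemma powerShiftGraph_shift_le {d k : ℕ} (hk : k < d) : 2 ^ (k + 1) + 1 ≤ 2 ^ (d + 1) := by
  have h1 : 2 ^ (k + 1) ≤ 2 ^ d := Nat.pow_le_pow_right (by norm_num) hk
  have h2 : 0 < 2 ^ d := by positivity
  rw [pow_succ 2 d]
  omega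

lemma powerShiftGraph_dist {d : ℕ} {v w : Fin n} (h : (powerShiftGraph n d).Adj v w) :
    w.val ≤ v.val + 2 ^ (d + 1) ∧ v.val ≤ w.val + 2 ^ (d + 1) := by
  rcases h with ⟨h0, k, hk, h⟩ | ⟨h0, k, hk, h⟩ <;>
    · have := powerShiftGraph_shift_le hk
      have : 0 < 2 ^ (k + 1) := by positivity
      omega

lemma card_nbrs_powerShiftGraph {d : ℕ} {v : Fin n} (h1 : 2 ^ (d + 1) ≤ v.val)
    (h2 : v.val + 2 ^ (d + 1) < n) : #(nbrs (powerShiftGraph n d) v) = d := by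
  have inj : ∀ {a b : ℕ}, 2 ^ (a + 1) + 1 = 2 ^ (b + 1) + 1 → a = b := fun h =>
    Nat.succ_injective (Nat.pow_right_injective le_rfl (Nat.succ_injective h))
  rw [← card_range d]
  symm
  have hpos : 0 < 2 ^ (d + 1) := by positivity
  rcases Nat.mod_two_eq_zero_or_one v.val with hv | hv
  · refine card_bij (fun k hk => ⟨v.val + (2 ^ (k + 1) + 1), ?_⟩) ?_ ?_ ?_
    · have := powerShiftGraph_shift_le (mem_range.1 hk)
      omega
    · intro k hk
      rw [card_range, mem_nbrs, powerShiftGraph_adj_of_even hv]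
      exact ⟨k, mem_range.1 hk, rfl⟩
    · intro a _ b _ h
      rw [Fin.mk.injEq] at h
      exact inj (by omega)
    · intro w hw
      rw [card_range, mem_nbrs, powerShiftGraph_adj_of_even hv] at hw
      obtain ⟨k, hk, h⟩ := hw
      exact ⟨k, mem_range.2 hk, Fin.ext h.symm⟩
  · refine card_bij (fun k hk => ⟨v.val - (2 ^ (k + 1) + 1), ?_⟩) ?_ ?_ ?_
    · have : 0 < 2 ^ (k + 1) := by positivity
      omega
    · intro k hk
      rw [card_range, mem_nbrs, powerShiftGraph_adj_of_odd hv]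
      have := powerShiftGraph_shift_le (mem_range.1 hk)
      exact ⟨k, mem_range.1 hk, by simp only; omega⟩
    · intro a ha b hb h
      have h3 := powerShiftGraph_shift_le (mem_range.1 ha)
      have h4 := powerShiftGraph_shift_le (mem_range.1 hb)
      rw [Fin.mk.injEq] at h
      exact inj (by omega)
    · intro w hw
      rw [card_range, mem_nbrs, powerShiftGraph_adj_of_odd hv] at hw
      obtain ⟨k, hk, h⟩ := hw
      exact ⟨k, mem_range.2 hk, Fin.ext (by simp only; omega)⟩

lemma utility_powerShiftGraph (hq : 0 < q) {d : ℕ} {v : Fin n} (h1 : 2 * 2 ^ (d + 1) ≤ v.val)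
    (h2 : v.val + 2 * 2 ^ (d + 1) < n) :
    utility q p 0 (powerShiftGraph n d) v = treeUtility q p d := by
  refine utility_eq_treeUtility hq (card_nbrs_powerShiftGraph (by omega) (by omega)) ?_ ?_ ?_
  · intro k hk
    have := powerShiftGraph_dist hk
    exact card_nbrs_powerShiftGraph (by omega) (by omega)
  · intro k k' hk hk' h
    have := powerShiftGraph_parity hk
    have := powerShiftGraph_parity hk'
    have := powerShiftGraph_parity h
    omega
  · intro k k' l hk hk' hl hl'
    have hp1 := powerShiftGraph_parity hk
    have hp2 := powerShiftGraph_parity hl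
    rcases Nat.mod_two_eq_zero_or_one v.val with hv | hv
    · have hlv : l.val % 2 = 0 := by omega
      rw [powerShiftGraph_adj_of_even hv] at hk hk'
      rw [SimpleGraph.adj_comm, powerShiftGraph_adj_of_even hlv] at hl hl'
      obtain ⟨a, -, ha⟩ := hk
      obtain ⟨b, -, hb⟩ := hk'
      obtain ⟨c, -, hc⟩ := hl
      obtain ⟨e, -, he⟩ := hl'
      rcases two_pow_add_two_pow_eq (a := a + 1) (b := e + 1) (c := b + 1) (e := c + 1)
        (by omega) with h | h
      · left; rw [h] at ha; exact Fin.ext (by omega)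
      · right; rw [h] at ha; exact Fin.ext (by omega)
    · have hlv : l.val % 2 = 1 := by omega
      rw [powerShiftGraph_adj_of_odd hv] at hk hk'
      rw [SimpleGraph.adj_comm, powerShiftGraph_adj_of_odd hlv] at hl hl'
      obtain ⟨a, -, ha⟩ := hk
      obtain ⟨b, -, hb⟩ := hk'
      obtain ⟨c, -, hc⟩ := hl
      obtain ⟨e, -, he⟩ := hl'
      rcases two_pow_add_two_pow_eq (a := a + 1) (b := e + 1) (c := b + 1) (e := c + 1)
        (by omega) with h | h
      · left; rw [h] at ha; exact Fin.ext (by omega)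
      · right; rw [h] at ha; exact Fin.ext (by omega)

lemma le_welfare_powerShiftGraph (hq : 0 < q) (hp : 0 < p) (hpq : p + q ≤ 1) (n d : ℕ) :
    n * treeUtility q p d - 4 * 2 ^ (d + 1) ≤ welfare q p 0 (powerShiftGraph n d) := by
  set L := 2 ^ (d + 1) with hL
  let B₁ : Finset (Fin n) := {v | v.val < 2 * L}
  let B₂ : Finset (Fin n) := {v | n ≤ v.val + 2 * L}
  have hB₁ : #B₁ ≤ 2 * L := by
    rw [← card_range (2 * L)]
    refine card_le_card_of_injOn (fun v => v.val) (fun v hv => ?_) fun v _ w _ h => Fin.ext h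
    simpa [B₁] using hv
  have hB₂ : #B₂ ≤ 2 * L := by
    rw [← card_range (2 * L)]
    refine card_le_card_of_injOn (fun v => n - 1 - v.val) (fun v hv => ?_) fun v _ w _ h => ?_
    · simp only [B₂, coe_filter, mem_univ, true_and, Set.mem_ofPred_eq] at hv
      have := v.isLt
      simp only [coe_range, Set.mem_Iio]
      omega
    · have := v.isLt
      have := w.isLt
      simp only at h
      exact Fin.ext (by omega)
  have hB : #(B₁ ∪ B₂) ≤ 4 * L := (card_union_le _ _).trans (by omega)
  have hdiff : ∑ v, (treeUtility q p d - utility q p 0 (powerShiftGraph n d) v)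
      ≤ ∑ v, if v ∈ B₁ ∪ B₂ then (1 : ℝ) else 0 := by
    refine sum_le_sum fun v _ => ?_
    split_ifs with hv
    · have := treeUtility_le_one hq hp hpq d
      have := utility_nonneg hq hp hpq (powerShiftGraph n d) v
      linarith
    · simp only [B₁, B₂, mem_union, mem_filter, mem_univ, true_and, not_or, not_lt, not_le] at hv
      rw [utility_powerShiftGraph hq hv.1 hv.2, sub_self]
  rw [sum_ite_mem, univ_inter, sum_const, sum_sub_distrib, sum_const] at hdiff
  simp only [card_univ, Fintype.card_fin, nsmul_eq_mul, mul_one] at hdiff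
  have hB' : (#(B₁ ∪ B₂) : ℝ) ≤ 4 * L := by exact_mod_cast hB
  have hLr : (L : ℝ) = 2 ^ (d + 1) := by rw [hL]; push_cast; rfl
  rw [hLr] at hB'
  unfold welfare
  linarith

end Tree

/-! ### The complete network -/

section Complete

variable {n : ℕ} {q p : ℝ}

lemma nbrs_top (i : Fin n) : nbrs (⊤ : SimpleGraph (Fin n)) i = univ.erase i := by
  ext j
  simp [eq_comm]

lemma prod_missProb_top_le (i : Fin n) (x : Fin n → Fin 3) :
    ∏ k ∈ nbrs ⊤ i, missProb ⊤ i k x ≤ Real.exp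
      (-((#{l ∈ univ.erase i | x l = 2} : ℝ) / (1 + (#{l ∈ univ.erase i | x l = 0} : ℝ)))) := by
  set K : ℝ := 1 + (#{l ∈ univ.erase i | x l = 0} : ℝ) with hK
  have hfac : ∀ k ∈ univ.erase i,
      missProb ⊤ i k x ≤ Real.exp (-(if x k = 2 then 1 / K else 0)) := by
    intro k _
    have hval : missProb ⊤ i k x = 1 - if x k = 2 then 1 / K else 0 := by
      by_cases hk : x k = 2
      · have : ({l ∈ (nbrs ⊤ k).erase i | x l = 0} : Finset (Fin n))
            = {l ∈ univ.erase i | x l = 0} := by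
          ext l
          simp only [nbrs_top, mem_filter, mem_erase, mem_univ, and_true]
          refine ⟨fun h => ⟨h.1.1, h.2⟩, fun h => ⟨⟨h.1, ?_⟩, h.2⟩⟩
          rintro rfl
          rw [hk] at h
          simp at h
        simp only [missProb, this, hK]
      · simp [missProb, hk]
    have := Real.add_one_le_exp (-(if x k = 2 then 1 / K else 0))
    linarith
  rw [nbrs_top]
  refine (prod_le_prod (fun k _ => missProb_nonneg i k x) hfac).trans_eq ?_
  rw [← Real.exp_sum, sum_neg_distrib, ← sum_filter, sum_const, nsmul_eq_mul, mul_one_div]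

/-- A bound for `exp (-D / K)` with `K = 1 + Z` when `Z` is near `q * m` and `D` near `t * Z`; if
`Z` is below half of `q * m`, the last term alone exceeds `1`. -/
lemma exp_neg_div_le {t Z D m a : ℝ} (hq : 0 < q) (ht : 0 ≤ t) (hZ : 0 ≤ Z) (hD : 0 ≤ D)
    (ha : 0 < a) (hm : m = a ^ 2) :
    Real.exp (-(D / (1 + Z))) ≤ Real.exp (-t) + (2 * t / (q * m)
      + 1 / (q * m) * (a⁻¹ * (t * Z - D) ^ 2 + a) + 4 / (q * m) ^ 2 * (Z - m * q) ^ 2) := by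
  have hm0 : 0 < m := by rw [hm]; positivity
  have hqm : 0 < q * m := by positivity
  rcases le_total (q * m / 2) (1 + Z) with h | h
  · have hW : 2 * |t * Z - D| ≤ a⁻¹ * (t * Z - D) ^ 2 + a := by
      rw [inv_mul_eq_div, div_add' _ _ _ ha.ne', le_div_iff₀ ha, ← sq_abs (t * Z - D)]
      nlinarith [sq_nonneg (|t * Z - D| - a)]
    have hlast : 0 ≤ 4 / (q * m) ^ 2 * (Z - m * q) ^ 2 := by positivity
    have hdiff : Real.exp (-(D / (1 + Z))) ≤ Real.exp (-t) + (t + |t * Z - D|) / (1 + Z) := by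
      have hle : t - D / (1 + Z) ≤ (t + |t * Z - D|) / (1 + Z) := by
        rw [le_div_iff₀ (by positivity), sub_mul, div_mul_cancel₀ _ (by positivity)]
        linarith [le_abs_self (t * Z - D)]
      have h1 := Real.add_one_le_exp (-(t - D / (1 + Z)))
      have h2 : Real.exp (-t) = Real.exp (-(D / (1 + Z))) * Real.exp (-(t - D / (1 + Z))) := by
        rw [← Real.exp_add]; congr 1; ring
      have h3 : Real.exp (-(D / (1 + Z))) ≤ 1 := Real.exp_le_one_iff.2 (by
        rw [neg_nonpos]; positivity)
      have h4 := Real.exp_pos (-(D / (1 + Z)))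
      have h5 : 0 ≤ (t + |t * Z - D|) / (1 + Z) := by positivity
      rw [h2]
      rcases le_total 0 (t - D / (1 + Z)) with h0 | h0
      · nlinarith
      · nlinarith
    have hbd : (t + |t * Z - D|) / (1 + Z) ≤ (t + |t * Z - D|) / (q * m / 2) := by
      gcongr
    have heq : (t + |t * Z - D|) / (q * m / 2)
        = 2 * t / (q * m) + 1 / (q * m) * (2 * |t * Z - D|) := by
      field_simp
    have hmul : 1 / (q * m) * (2 * |t * Z - D|) ≤ 1 / (q * m) * (a⁻¹ * (t * Z - D) ^ 2 + a) := by
      gcongr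
    linarith
  · have h1 : 1 ≤ 4 / (q * m) ^ 2 * (Z - m * q) ^ 2 := by
      rw [div_mul_eq_mul_div, one_le_div (by positivity)]
      nlinarith
    have h2 : Real.exp (-(D / (1 + Z))) ≤ 1 := Real.exp_le_one_iff.2 (by
      rw [neg_nonpos]; positivity)
    have h3 : 0 ≤ 2 * t / (q * m) := by positivity
    have h4 : 0 ≤ 1 / (q * m) * (a⁻¹ * (t * Z - D) ^ 2 + a) := by positivity
    have := Real.exp_pos (-t)
    linarith

/-- In the complete network an individual faces about `p * n` donors shared among about `q * n`
needy individuals; both counts are controlled by their second moments. -/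
lemma le_utility_top (hq : 0 < q) (hp : 0 < p) (hpq : p + q ≤ 1) {m : ℕ} (hm : 0 < m)
    (i : Fin (m + 1)) :
    1 - q * (Real.exp (-(p / q)) + (2 * (p / q) / (q * m)
      + ((p / q + 1) ^ 2 + 1) / (q * √m) + 4 / (q ^ 2 * m))) ≤ utility q p 0 ⊤ i := by
  set t := p / q with ht
  have ht0 : 0 < t := by positivity
  have hmr : (0 : ℝ) < m := by exact_mod_cast hm
  have ha : 0 < √(m : ℝ) := Real.sqrt_pos.2 hmr
  have ha2 : (m : ℝ) = √(m : ℝ) ^ 2 := (Real.sq_sqrt hmr.le).symm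
  set s : Finset (Fin (m + 1)) := univ.erase i with hs
  have hcard : #s = m := by simp [hs]
  have hZ : ∀ x : Fin (m + 1) → Fin 3, (#{l ∈ s | x l = 0} : ℝ) - m * q
      = ∑ j ∈ s, ((if x j = 0 then 1 else 0) - q) := by
    intro x
    rw [sum_sub_distrib, sum_const, hcard, nsmul_eq_mul, sum_boole]
  have hD : ∀ x : Fin (m + 1) → Fin 3,
      t * (#{l ∈ s | x l = 0} : ℝ) - (#{l ∈ s | x l = 2} : ℝ)
        = ∑ j ∈ s, (t * (if x j = 0 then 1 else 0) - (if x j = 2 then 1 else 0)) := by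
    intro x
    rw [sum_sub_distrib, ← mul_sum, sum_boole, sum_boole]
  have hZ2 := expect_sum_sq_le hq hp hpq s (fun k => (if k = 0 then 1 else 0) - q)
    (by rw [sum_exoProb_mul]; simp; ring) (C := 1) (by
      intro k
      split_ifs <;> nlinarith)
  have hD2 := expect_sum_sq_le hq hp hpq s
    (fun k => t * (if k = 0 then 1 else 0) - (if k = 2 then 1 else 0))
    (by
      rw [sum_exoProb_mul]
      simp only [Fin.reduceEq, if_true, if_false]
      rw [ht]; field_simp; ring) (C := (t + 1) ^ 2) (by
      intro k
      split_ifs <;> nlinarith)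
  simp only [← hZ, hcard, mul_one] at hZ2
  simp only [← hD, hcard] at hD2
  rw [utility_eq]
  refine sub_le_sub_left (mul_le_mul_of_nonneg_left ?_ hq.le) 1
  have hpt := expect_mono hq hp hpq fun x : Fin (m + 1) → Fin 3 =>
    (prod_missProb_top_le i x).trans (exp_neg_div_le (t := t) hq ht0.le
      (Nat.cast_nonneg _) (Nat.cast_nonneg _) ha ha2)
  refine hpt.trans ?_
  simp only [expect_add, expect_const, expect_const_mul]
  rw [add_le_add_iff_left, add_assoc, add_assoc, add_le_add_iff_left]
  refine add_le_add ?_ ?_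
  · calc 1 / (q * m) * ((√(m : ℝ))⁻¹ * expect q p (fun x : Fin (m + 1) → Fin 3 =>
          (t * (#{l ∈ s | x l = 0} : ℝ) - (#{l ∈ s | x l = 2} : ℝ)) ^ 2) + √(m : ℝ))
        ≤ 1 / (q * m) * ((√(m : ℝ))⁻¹ * (m * (t + 1) ^ 2) + √(m : ℝ)) := by gcongr
      _ = ((t + 1) ^ 2 + 1) / (q * √m) := by
        set a := √(m : ℝ)
        rw [ha2]
        field_simp
  · calc 4 / (q * m) ^ 2 * expect q p (fun x : Fin (m + 1) → Fin 3 =>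
          ((#{l ∈ s | x l = 0} : ℝ) - m * q) ^ 2) ≤ 4 / (q * m) ^ 2 * m := by gcongr
      _ = 4 / (q ^ 2 * m) := by field_simp

lemma utility_top_le (hq : 0 < q) (hp : 0 < p) (hpq : p + q ≤ 1) {m : ℕ} (i : Fin (m + 1)) :
    utility q p 0 ⊤ i ≤ treeUtility q p m := by
  refine (utility_le hq hp hpq ⊤ i).trans_eq ?_
  have hcard : ∀ k : Fin (m + 1), #(nbrs ⊤ k) = m := fun k => by simp [nbrs_top]
  simp only [hcard, prod_const, treeUtility]

end Complete

/-! ### Asymptotics -/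

section Limits

variable {q p : ℝ}

lemma tendsto_treeUtility (hq : 0 < q) (hp : 0 < p) (hpq : p + q ≤ 1) :
    Tendsto (treeUtility q p) atTop (nhds (1 - q * Real.exp (-(p / q)))) := by
  have hpow : Tendsto (fun d : ℕ => (1 - q) ^ d) atTop (nhds 0) :=
    tendsto_pow_atTop_nhds_zero_of_lt_one (by linarith) (by linarith)
  have hg : Tendsto (fun d : ℕ => (d : ℝ) * -(p / q * ((1 - (1 - q) ^ d) / (d : ℝ)))) atTop
      (nhds (-(p / q))) := by
    have h1 : Tendsto (fun d : ℕ => -(p / q) * (1 - (1 - q) ^ d)) atTop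
        (nhds (-(p / q) * (1 - 0))) := (tendsto_const_nhds.sub hpow).const_mul _
    rw [sub_zero, mul_one] at h1
    refine h1.congr' ?_
    filter_upwards [eventually_gt_atTop 0] with d hd
    have : (d : ℝ) ≠ 0 := by exact_mod_cast hd.ne'
    field_simp
  have := Real.tendsto_one_add_pow_exp_of_tendsto hg
  simp only [← sub_eq_add_neg] at this
  exact (this.const_mul q).const_sub 1

lemma tendsto_welfare_top_div (hq : 0 < q) (hp : 0 < p) (hpq : p + q ≤ 1) :
    Tendsto (fun n : ℕ => welfare q p 0 (⊤ : SimpleGraph (Fin n)) / n) atTop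
      (nhds (1 - q * Real.exp (-(p / q)))) := by
  rw [← tendsto_add_atTop_iff_nat 1]
  have hsq : Tendsto (fun m : ℕ => √(m : ℝ)) atTop atTop :=
    Real.tendsto_sqrt_atTop.comp tendsto_natCast_atTop_atTop
  have hlow : Tendsto (fun m : ℕ => 1 - q * (Real.exp (-(p / q)) + (2 * (p / q) / (q * m)
      + ((p / q + 1) ^ 2 + 1) / (q * √m) + 4 / (q ^ 2 * m)))) atTop
      (nhds (1 - q * (Real.exp (-(p / q)) + (0 + 0 + 0)))) := by
    have hnat := tendsto_natCast_atTop_atTop (R := ℝ)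
    refine ((((?_ : Tendsto _ _ _).add ?_).add ?_).const_add _ |>.const_mul _).const_sub _
    · exact (hnat.const_mul_atTop hq).const_div_atTop _
    · exact (hsq.const_mul_atTop hq).const_div_atTop _
    · exact (hnat.const_mul_atTop (by positivity)).const_div_atTop _
  simp only [add_zero] at hlow
  refine tendsto_of_tendsto_of_tendsto_of_le_of_le' hlow (tendsto_treeUtility hq hp hpq) ?_ ?_
  · filter_upwards [eventually_gt_atTop 0] with m hm
    rw [le_div_iff₀ (by positivity)]
    have := sum_le_sum fun (i : Fin (m + 1)) (_ : i ∈ univ) => le_utility_top hq hp hpq hm i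
    rw [sum_const, card_univ, Fintype.card_fin, nsmul_eq_mul, mul_comm] at this
    exact this
  · filter_upwards with m
    rw [div_le_iff₀ (by positivity)]
    have := sum_le_sum fun (i : Fin (m + 1)) (_ : i ∈ univ) => utility_top_le hq hp hpq i
    rw [sum_const, card_univ, Fintype.card_fin, nsmul_eq_mul, mul_comm] at this
    exact this

lemma welfare_le_iSup {n : ℕ} (E : SimpleGraph (Fin n)) :
    welfare q p 0 E ≤ ⨆ E : SimpleGraph (Fin n), welfare q p 0 E :=
  le_ciSup (f := fun E => welfare q p 0 E) (Set.finite_range _).bddAbove E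

/-- The maximal welfare per individual is asymptotically the best tree utility. Degrees beyond some
`D` do not beat the complete network by more than `ε`, and each of the finitely many smaller degrees
is realized by `powerShiftGraph`. -/
lemma tendsto_iSup_welfare_div_sub (hq : 0 < q) (hp : 0 < p) (hpq : p + q ≤ 1) :
    Tendsto (fun n : ℕ => (⨆ E : SimpleGraph (Fin n), welfare q p 0 E) / n
      - (range (n + 1)).sup' nonempty_range_add_one (treeUtility q p)) atTop (nhds 0) := by
  set b := 1 - q * Real.exp (-(p / q)) with hb
  rw [Metric.tendsto_atTop']
  intro ε hε
  obtain ⟨D, hD⟩ := eventually_atTop.1 ((tendsto_treeUtility hq hp hpq).eventually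
    (gt_mem_nhds (show b < b + ε / 2 by linarith)))
  have htop := (tendsto_welfare_top_div hq hp hpq).eventually
    (lt_mem_nhds (show b - ε / 2 < b by linarith))
  have hsmall : ∀ᶠ n : ℕ in atTop, ((4 * 2 ^ (D + 1) : ℝ) / n) < ε :=
    (tendsto_natCast_atTop_atTop.const_div_atTop _).eventually (gt_mem_nhds hε)
  obtain ⟨N, hN⟩ := eventually_atTop.1 (htop.and (hsmall.and (eventually_gt_atTop 0)))
  refine ⟨N, fun n hn => ?_⟩
  obtain ⟨h1, h2, h0⟩ := hN n hn.le
  have hn0 : (0 : ℝ) < n := by exact_mod_cast h0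
  rw [Real.dist_eq, sub_zero, abs_lt]
  have hle : (⨆ E : SimpleGraph (Fin n), welfare q p 0 E) / n
      ≤ (range (n + 1)).sup' nonempty_range_add_one (treeUtility q p) := by
    rw [div_le_iff₀ hn0, mul_comm]
    refine ciSup_le fun E => welfare_le hq hp hpq E fun d hd => ?_
    exact le_sup' (treeUtility q p) (by simpa using Nat.lt_succ_of_le hd)
  refine ⟨?_, by linarith⟩
  have hge : (range (n + 1)).sup' nonempty_range_add_one (treeUtility q p)
      < (⨆ E : SimpleGraph (Fin n), welfare q p 0 E) / n + ε := by
    rw [sup'_lt_iff]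
    intro d _
    rcases le_or_gt D d with hd | hd
    · have h3 : welfare q p 0 (⊤ : SimpleGraph (Fin n)) / n
          ≤ (⨆ E : SimpleGraph (Fin n), welfare q p 0 E) / n :=
        div_le_div_of_nonneg_right (welfare_le_iSup _) hn0.le
      have := hD d hd
      linarith
    · have h3 := (le_welfare_powerShiftGraph hq hp hpq n d).trans (welfare_le_iSup _)
      have h4 : (2 : ℝ) ^ (d + 1) ≤ 2 ^ (D + 1) :=
        pow_le_pow_right₀ (by norm_num) (by omega)
      rw [← sub_lt_iff_lt_add, lt_div_iff₀ hn0]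
      rw [div_lt_iff₀ hn0] at h2
      linarith
  linarith

end Limits

end IPNG

theorem mainTheorem12 (q p : ℝ) (hq : 0 < q) (hp : 0 < p) (hpq : p + q ≤ 1) :
    (∀ n : ℕ, ∃ E : SimpleGraph (Fin n), IPNG.IsDFPNE q p 0 E) ∧
    (fun n : ℕ =>
        IPNG.PoA n q p 0 -
          ((Finset.range (n + 1)).sup' Finset.nonempty_range_add_one
              (fun d : ℕ => 1 - q * (1 - p / q * ((1 - (1 - q) ^ d) / (d : ℝ))) ^ d)) /
            (1 - q * Real.exp (-(p / q))))
      =o[Filter.atTop] (fun _ : ℕ => (1 : ℝ)) := by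
  refine ⟨fun n => ⟨⊤, (IPNG.isDFPNE_iff_eq_top hq hp hpq).2 rfl⟩, ?_⟩
  rw [isLittleO_one_iff]
  change Tendsto (fun n : ℕ => IPNG.PoA n q p 0 -
    ((range (n + 1)).sup' nonempty_range_add_one (IPNG.treeUtility q p)) /
      (1 - q * Real.exp (-(p / q)))) atTop (nhds 0)
  set b := 1 - q * Real.exp (-(p / q)) with hb
  have hb0 : 0 < b := by
    have h1 : Real.exp (-(p / q)) < 1 := Real.exp_lt_one_iff.2 (neg_lt_zero.2 (by positivity))
    have h2 : q * Real.exp (-(p / q)) < q * 1 := mul_lt_mul_of_pos_left h1 hq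
    linarith
  set M : ℕ → ℝ := fun n => (range (n + 1)).sup' nonempty_range_add_one (IPNG.treeUtility q p)
    with hM
  set B : ℕ → ℝ := fun n => IPNG.welfare q p 0 (⊤ : SimpleGraph (Fin n)) / n with hB
  have hBt : Tendsto B atTop (nhds b) := IPNG.tendsto_welfare_top_div hq hp hpq
  have hA := IPNG.tendsto_iSup_welfare_div_sub hq hp hpq
  have hbdd : ∀ n, |M n| ≤ 1 := by
    intro n
    rw [abs_le]
    constructor
    · have := le_sup' (IPNG.treeUtility q p) (mem_range.2 (Nat.succ_pos n))
      have := IPNG.treeUtility_nonneg hq hp hpq 0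
      simp only [hM]
      linarith
    · exact sup'_le _ _ fun d _ => IPNG.treeUtility_le_one hq hp hpq d
  have hinv : Tendsto (fun n => (B n)⁻¹ - b⁻¹) atTop (nhds 0) := by
    have := (hBt.inv₀ hb0.ne').sub_const b⁻¹
    rwa [sub_self] at this
  have hprod : Tendsto (fun n => M n * ((B n)⁻¹ - b⁻¹)) atTop (nhds 0) :=
    bdd_le_mul_tendsto_zero' 1 (Eventually.of_forall hbdd) hinv
  -- with `A` the maximal welfare per individual,
  -- `A / B - M / b = (A - M) / B + M * (1 / B - 1 / b)`
  have hsum := (hA.mul (hBt.inv₀ hb0.ne')).add hprod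
  rw [zero_mul, zero_add] at hsum
  refine hsum.congr' ?_
  filter_upwards [eventually_gt_atTop 0] with n hn
  have hn0 : (n : ℝ) ≠ 0 := by exact_mod_cast hn.ne'
  have hPoA : IPNG.PoA n q p 0
      = ((⨆ E : SimpleGraph (Fin n), IPNG.welfare q p 0 E) / n) * (B n)⁻¹ := by
    rw [IPNG.PoA_eq hq hp hpq, hB, ← div_eq_mul_inv, div_div_div_cancel_right₀ hn0]
  rw [hPoA]
  simp only [hM]
  ring
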